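/- Let $K\subset\mathbb C$ be an imaginary quadratic field with discriminant $d_K$, let $\mathcal O_f=\mathbb Z+f\mathcal O_K$ be its order of conductor $f\ge 1$, and let $D=f^2d_K$ be the discriminant of $\mathcal O_f$. Let $\sqrt D$ be the square root with positive imaginary part, and write $[\beta_1,\beta_2]=\mathbb Z\beta_1+\mathbb Z\beta_2$. Let $p_1,p_2$ be primes and $N=p_1p_2$, and assume, with $\left(\frac{D}{p}\right)$ the Kronecker symbol, that 1. if $p_1\ne p_2$, then $\left(\frac{D}{p_1}\right)\ne-1$, $\left(\frac{D}{p_2}\right)\neq -1$ and $p_1,p_2\nmid f$; 2. if $p_1=p_2=p\ne 2$, then $\left(\frac{D}{p}\right)=1$ or $p\mid f$; 3. if $p_1=p_2=2$, then $\left(\frac{D}{2}\right)=1$ or $2\mid f$, and $D\not\equiv 4\pmod{32}$. An $N$-system for $D$ is a set $\mathfrak N$ of primitive positive definite forms $[A,B,C]=AX^2+BXY+CY^2$ with integer coefficients and discriminant $B^2-4AC=D$, such that every form in $\mathfrak N$ has $\gcd(A,N)=1$ and $N\mid C$, any two forms in $\mathfrak N$ have middle coefficients congruent modulo $2N$, and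 the ideals $[A,\frac{-B+\sqrt D}{2}]$ of the forms in $\mathfrak N$ represent every class of proper ideals of $\mathcal O_f$ exactly once. Let $\mathfrak q=[A,B,C]$ be a form in an $N$-system for $D$, and put $\mathfrak a_{\mathfrak q}=[A,\frac{-B+\sqrt D}{2}]$ and $W_N(\mathfrak a_{\mathfrak q})=[\frac CN,\frac{B+\sqrt D}{2}]$. For a lattice $\mathfrak a=[\beta_1,\beta_2]$ with $\operatorname{Im}(\beta_1/\beta_2)>0$, let $J(\mathfrak a)=J(\beta_1/\beta_2)$, where $J=E_4^3/\Delta$ is the modular invariant; this does not depend on the basis. If $J(W_N(\mathfrak a_{\mathfrak q}))=J(\mathfrak a_{\mathfrak q})$, then $D\ge -4N$, and equality $D=-4N$ holds if and only if $B\equiv 0\pmod{2N}$. In particular $D>-4N$ whenever $B\not\equiv 0\pmod{2N}$. -/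

import Mathlib

open scoped UpperHalfPlane

noncomputable section

/-- The modular invariant `J = E₄³ / Δ` (with `q`-expansion `q⁻¹ + 744 + ⋯`). -/
def modularJ (τ : ℍ) : ℂ :=
  (ModularForm.E (k := 4) (by norm_num) τ) ^ 3 / ModularForm.discriminant τ

/-- `τ` is a basis quotient of the lattice `𝔞`: one has `𝔞 = ℤ β₁ + ℤ β₂` and `τ = β₁ / β₂`, with
`τ` in the upper half-plane. -/
def IsBasisQuotient (𝔞 : Submodule ℤ ℂ) (τ : ℍ) : Prop :=
  ∃ β₁ β₂ : ℂ, β₂ ≠ 0 ∧ 𝔞 = Submodule.span ℤ {β₁, β₂} ∧ (τ : ℂ) = β₁ / β₂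

open Classical in
/-- `J(𝔞)` is the value of `J` at a basis quotient of `𝔞`. It does not depend on the basis quotient,
see `idealJ_eq`. (The value is `0` if `𝔞` is not a lattice, which never occurs for ideals.) -/
def idealJ (𝔞 : Submodule ℤ ℂ) : ℂ :=
  if h : ∃ τ : ℍ, IsBasisQuotient 𝔞 τ then modularJ h.choose else 0

/-- `J` is invariant under `SL(2, ℤ)`. -/
theorem modularJ_smul (g : Matrix.SpecialLinearGroup (Fin 2) ℤ) (τ : ℍ) :
    modularJ (g • τ) = modularJ τ := by
  have h4 : ModularForm.E (k := 4) (by norm_num) (g • τ) =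
      UpperHalfPlane.denom g τ ^ ((4 : ℕ) : ℤ) * ModularForm.E (k := 4) (by norm_num) τ :=
    SlashInvariantForm.slash_action_eqn'' (ModularForm.E (k := 4) (by norm_num))
      (Γ := (Matrix.SpecialLinearGroup.mapGL ℝ).range)
      (γ := Matrix.SpecialLinearGroup.mapGL ℝ g) ⟨g, rfl⟩ τ
  have h12 : ModularForm.discriminant (g • τ) =
      UpperHalfPlane.denom g τ ^ (12 : ℤ) * ModularForm.discriminant τ :=
    SlashInvariantForm.slash_action_eqn'' CuspForm.discriminant
      (Γ := (Matrix.SpecialLinearGroup.mapGL ℝ).range)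
      (γ := Matrix.SpecialLinearGroup.mapGL ℝ g) ⟨g, rfl⟩ τ
  have hd := UpperHalfPlane.denom_ne_zero g τ
  have hΔ := ModularForm.discriminant_ne_zero τ
  unfold modularJ
  rw [h4, h12]
  field_simp
  rw [zpow_natCast]
  ring

/-- The value `J(𝔞)` is independent of the basis quotient. -/
theorem idealJ_eq {𝔞 : Submodule ℤ ℂ} {τ : ℍ} (h : IsBasisQuotient 𝔞 τ) :
    idealJ 𝔞 = modularJ τ := by
  have hex : ∃ τ : ℍ, IsBasisQuotient 𝔞 τ := ⟨τ, h⟩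
  rw [idealJ, dif_pos hex]
  obtain ⟨γ₁, γ₂, hγ, hspan', hσ⟩ := hex.choose_spec
  generalize hex.choose = σ at *
  obtain ⟨β₁, β₂, hβ, hspan, hτ⟩ := h
  have key : ∀ {x y z : ℂ}, x ∈ Submodule.span ℤ {y, z} → ∃ a b : ℤ, x = a * y + b * z := by
    intro x y z hx
    obtain ⟨a, b, h⟩ := Submodule.mem_span_pair.1 hx
    exact ⟨a, b, by simpa using h.symm⟩
  have hm : ∀ {x}, x ∈ ({γ₁, γ₂} : Set ℂ) → x ∈ Submodule.span ℤ {β₁, β₂} := by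
    intro x hx
    rw [← hspan, hspan']
    exact Submodule.subset_span hx
  have hm' : ∀ {x}, x ∈ ({β₁, β₂} : Set ℂ) → x ∈ Submodule.span ℤ {γ₁, γ₂} := by
    intro x hx
    rw [← hspan', hspan]
    exact Submodule.subset_span hx
  obtain ⟨a, b, h1⟩ := key (hm (x := γ₁) (by simp))
  obtain ⟨c, d, h2⟩ := key (hm (x := γ₂) (by simp))
  obtain ⟨a', b', h1'⟩ := key (hm' (x := β₁) (by simp))
  obtain ⟨c', d', h2'⟩ := key (hm' (x := β₂) (by simp))
  have e1 : β₁ = τ * β₂ := by rw [hτ]; field_simp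
  have e2 : γ₁ = σ * γ₂ := by rw [hσ]; field_simp
  rw [e1, e2] at h1 h1'
  rw [e1] at h2
  rw [e2] at h2'
  have r1 : (σ : ℂ) * (c * τ + d) = a * τ + b := by
    apply mul_right_cancel₀ hβ
    linear_combination h1 - σ * h2
  have r2 : (τ : ℂ) * (c' * σ + d') = a' * σ + b' := by
    apply mul_right_cancel₀ hγ
    linear_combination h1' - τ * h2'
  have r3 : (c * τ + d : ℂ) * (c' * σ + d') = 1 := by
    apply mul_right_cancel₀ hγ
    linear_combination -h2 - (c * τ + d : ℂ) * h2'
  have im : ∀ {s t : ℍ} {a b c d : ℤ}, (s : ℂ) * (c * t + d) = a * t + b →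
      s.im * Complex.normSq (c * t + d) = ((a * d - b * c : ℤ) : ℝ) * t.im := by
    intro s t a b c d h
    have h1 := congrArg Complex.re h
    have h2 := congrArg Complex.im h
    simp at h1 h2
    simp [Complex.normSq_apply]
    linear_combination (c * t.re + d) * h2 - c * t.im * h1
  have i1 := im r1
  have i2 := im r2
  have n3 := congrArg Complex.normSq r3
  rw [map_mul, map_one] at n3
  have n1 : 0 < Complex.normSq (c * τ + d) :=
    Complex.normSq_pos.2 (left_ne_zero_of_mul_eq_one r3)
  have n2 : 0 < Complex.normSq (c' * σ + d') :=
    Complex.normSq_pos.2 (right_ne_zero_of_mul_eq_one r3)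
  have p1 : 0 < a * d - b * c := by
    have := mul_pos σ.im_pos n1
    rw [i1] at this
    exact_mod_cast pos_of_mul_pos_left this τ.im_pos.le
  have p2 : 0 < a' * d' - b' * c' := by
    have := mul_pos τ.im_pos n2
    rw [i2] at this
    exact_mod_cast pos_of_mul_pos_left this σ.im_pos.le
  have p3 : (a * d - b * c) * (a' * d' - b' * c') = 1 := by
    have hpos : (σ.im * τ.im : ℝ) ≠ 0 := (mul_pos σ.im_pos τ.im_pos).ne'
    have : (((a * d - b * c : ℤ) : ℝ) * ((a' * d' - b' * c' : ℤ) : ℝ)) = 1 := by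
      apply mul_right_cancel₀ hpos
      calc _ = (((a * d - b * c : ℤ) : ℝ) * τ.im) * (((a' * d' - b' * c' : ℤ) : ℝ) * σ.im) := by
            ring
        _ = _ := by
            rw [← i1, ← i2]
            linear_combination σ.im * τ.im * n3
    exact_mod_cast this
  have hdet : a * d - b * c = 1 := by
    rcases Int.eq_one_or_neg_one_of_mul_eq_one p3 with h | h <;> omega
  let g : Matrix.SpecialLinearGroup (Fin 2) ℤ :=
    ⟨!![a, b; c, d], by rw [Matrix.det_fin_two_of, hdet]⟩
  have hg : g • τ = σ := by
    ext
    rw [UpperHalfPlane.coe_specialLinearGroup_apply]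
    simp [g]
    rw [← r1, mul_div_cancel_right₀ _ (left_ne_zero_of_mul_eq_one r3)]
  rw [← hg, modularJ_smul]

/-- The order `ℤ + f 𝓞_K` of conductor `f` in the number field `K ⊆ ℂ`. -/
def orderOfConductor (K : Subfield ℂ) (f : ℕ) : Subring ℂ where
  carrier := {x | ∃ (n : ℤ) (y : NumberField.RingOfIntegers K), x = n + f * ((y : K) : ℂ)}
  mul_mem' := by
    rintro _ _ ⟨n, y, rfl⟩ ⟨n', y', rfl⟩
    refine ⟨n * n', (n : NumberField.RingOfIntegers K) * y' + n' * y + f * (y * y'), ?_⟩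
    simp only [map_add, map_mul, map_natCast, map_intCast, Subfield.coe_add, Subfield.coe_mul,
      SubringClass.coe_intCast, SubringClass.coe_natCast]
    push_cast
    ring
  one_mem' := ⟨1, 0, by simp⟩
  add_mem' := by
    rintro _ _ ⟨n, y, rfl⟩ ⟨n', y', rfl⟩
    refine ⟨n + n', y + y', ?_⟩
    push_cast
    ring
  zero_mem' := ⟨0, 0, by simp⟩
  neg_mem' := by
    rintro _ ⟨n, y, rfl⟩
    refine ⟨-n, -y, ?_⟩
    push_cast
    ring

/-- `𝔞` is a nonzero proper ideal of the order `O ⊆ ℂ`: it is an ideal contained in `O` whose ring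
of multipliers is exactly `O`. -/
structure IsProperIdeal (O : Subring ℂ) (𝔞 : Submodule ℤ ℂ) : Prop where
  ne_bot : 𝔞 ≠ ⊥
  subset : ∀ x ∈ 𝔞, x ∈ O
  multiplier : ∀ x : ℂ, (∀ y ∈ 𝔞, x * y ∈ 𝔞) ↔ x ∈ O

/-- Two ideals of `O` are in the same ideal class: `α 𝔞 = β 𝔟` for some nonzero `α, β` in `O`. -/
def SameIdealClass (O : Subring ℂ) (𝔞 𝔟 : Submodule ℤ ℂ) : Prop :=
  ∃ α ∈ O, ∃ β ∈ O, α ≠ 0 ∧ β ≠ 0 ∧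
    𝔞.map (LinearMap.mulLeft ℤ α) = 𝔟.map (LinearMap.mulLeft ℤ β)

/-- A binary quadratic form `A X² + B X Y + C Y²` with integral coefficients. -/
@[ext] structure QuadForm where
  A : ℤ
  B : ℤ
  C : ℤ

namespace QuadForm

/-- The discriminant of a binary quadratic form. -/
def disc (q : QuadForm) : ℤ := q.B ^ 2 - 4 * q.A * q.C

/-- The coefficients have no common divisor other than `±1`. -/
def IsPrimitive (q : QuadForm) : Prop := Int.gcd (Int.gcd q.A q.B) q.C = 1

end QuadForm

/-- `√D` for a negative integer `D`, with positive imaginary part. -/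
def sqrtNeg (D : ℤ) : ℂ := Complex.I * (Real.sqrt (-(D : ℝ)) : ℂ)

/-- The ideal `𝔞_q = [A, (-B + √D) / 2]` of the form `q = [A, B, C]` of discriminant `D`. -/
def formIdeal (D : ℤ) (q : QuadForm) : Submodule ℤ ℂ :=
  Submodule.span ℤ {(q.A : ℂ), (-(q.B : ℂ) + sqrtNeg D) / 2}

/-- The ideal `W_N(𝔞_q) = [C / N, (B + √D) / 2]`, for a form `q = [A, B, C]` of discriminant `D`
with `N ∣ C`. Its basis quotient is the image of `α_q = (-B + √D) / (2A)` under the Atkin-Lehner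
involution `W_N(τ) = N / (-τ)`, see `isBasisQuotient_atkinLehnerIdeal`. -/
def atkinLehnerIdeal (N : ℕ) (D : ℤ) (q : QuadForm) : Submodule ℤ ℂ :=
  Submodule.span ℤ {(q.C : ℂ) / (N : ℂ), ((q.B : ℂ) + sqrtNeg D) / 2}

/-- The basis quotient of `𝔞_q` is `α_q = (-B + √D) / (2A)`. -/
theorem isBasisQuotient_formIdeal {D : ℤ} {q : QuadForm} (hA : 0 < q.A) {τ : ℍ}
    (hτ : (τ : ℂ) = (-(q.B : ℂ) + sqrtNeg D) / (2 * q.A)) :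
    IsBasisQuotient (formIdeal D q) τ := by
  have hA' : (q.A : ℂ) ≠ 0 := by exact_mod_cast hA.ne'
  refine ⟨(-(q.B : ℂ) + sqrtNeg D) / 2, q.A, hA', ?_, ?_⟩
  · rw [formIdeal, Set.pair_comm]
  · rw [hτ]
    field_simp

/-- The basis quotient of `W_N(𝔞_q)` is `N / (-α_q)`. -/
theorem isBasisQuotient_atkinLehnerIdeal {N : ℕ} {D : ℤ} {q : QuadForm} (hN : N ≠ 0) (hD : D < 0)
    (hq : q.disc = D) (hA : 0 < q.A) {τ : ℍ}
    (hτ : (τ : ℂ) = N / -((-(q.B : ℂ) + sqrtNeg D) / (2 * q.A))) :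
    IsBasisQuotient (atkinLehnerIdeal N D q) τ := by
  have hA' : (q.A : ℂ) ≠ 0 := by exact_mod_cast hA.ne'
  have hN' : (N : ℂ) ≠ 0 := by exact_mod_cast hN
  have hC : (q.C : ℂ) ≠ 0 := by
    have : q.C ≠ 0 := by
      intro h
      rw [QuadForm.disc, h] at hq
      nlinarith [sq_nonneg q.B]
    exact_mod_cast this
  have hs : sqrtNeg D ^ 2 = (q.B : ℂ) ^ 2 - 4 * q.A * q.C := by
    have h0 : (0 : ℝ) ≤ -(D : ℝ) := by
      have : (D : ℝ) < 0 := by exact_mod_cast hD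
      linarith
    rw [sqrtNeg, mul_pow, Complex.I_sq, ← Complex.ofReal_pow, Real.sq_sqrt h0, ← hq,
      QuadForm.disc]
    push_cast
    ring
  have hne : -(q.B : ℂ) + sqrtNeg D ≠ 0 := by
    intro h
    have : sqrtNeg D = q.B := by linear_combination h
    rw [this] at hs
    have : (q.A : ℂ) * q.C = 0 := by linear_combination hs / 4
    exact (mul_ne_zero hA' hC) this
  refine ⟨((q.B : ℂ) + sqrtNeg D) / 2, q.C / N, div_ne_zero hC hN', ?_, ?_⟩
  · rw [atkinLehnerIdeal, Set.pair_comm]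
  · rw [hτ]
    field_simp
    linear_combination -hs

/-- `𝔑` is an `N`-system for the discriminant `D` of the order `O`: a set of primitive (positive
definite) forms `[A, B, C]` of discriminant `D` with `gcd(A, N) = 1`, `N ∣ C` and all `B` congruent
modulo `2N`, whose ideals are a system of representatives of the proper ideal classes of `O`. (So
the number of forms is the class number of `O`.) -/
structure IsNSystem (O : Subring ℂ) (N : ℕ) (D : ℤ) (𝔑 : Set QuadForm) : Prop where
  disc_eq : ∀ q ∈ 𝔑, q.disc = D
  primitive : ∀ q ∈ 𝔑, q.IsPrimitive
  pos : ∀ q ∈ 𝔑, 0 < q.A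
  coprime : ∀ q ∈ 𝔑, IsCoprime q.A (N : ℤ)
  dvd : ∀ q ∈ 𝔑, (N : ℤ) ∣ q.C
  congr : ∀ q ∈ 𝔑, ∀ q' ∈ 𝔑, q.B ≡ q'.B [ZMOD (2 * N : ℤ)]
  proper : ∀ q ∈ 𝔑, IsProperIdeal O (formIdeal D q)
  represents : ∀ 𝔞 : Submodule ℤ ℂ, IsProperIdeal O 𝔞 →
    ∃! q : QuadForm, q ∈ 𝔑 ∧ SameIdealClass O (formIdeal D q) 𝔞

/-- The Kronecker symbol `(D / p)` for a prime `p` and a discriminant `D` (so `D ≡ 0, 1 mod 4`). -/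
def kroneckerSymbol (D : ℤ) (p : ℕ) : ℤ :=
  if p = 2 then ZMod.χ₈ (D : ZMod 8) else jacobiSym D p

/-- The conditions on the primes `p₁, p₂` with respect to the discriminant `D` of the order of
conductor `f`, under which class polynomials of double eta-quotients are integral. -/
structure AdmissiblePrimes (D : ℤ) (f p₁ p₂ : ℕ) : Prop where
  ne : p₁ ≠ p₂ → kroneckerSymbol D p₁ ≠ -1 ∧ kroneckerSymbol D p₂ ≠ -1 ∧ ¬ p₁ ∣ f ∧ ¬ p₂ ∣ f
  eq_odd : p₁ = p₂ → p₁ ≠ 2 → kroneckerSymbol D p₁ = 1 ∨ p₁ ∣ f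
  eq_two : p₁ = p₂ → p₁ = 2 → (kroneckerSymbol D 2 = 1 ∨ 2 ∣ f) ∧ ¬ D ≡ 4 [ZMOD 32]

end

/-! With `α = (-B + √D) / (2A)`, the hypothesis reads `J(-N/α) = J(α)`. Since `J` separates `SL(2,
ℤ)`-orbits, some matrix with entries `a, b, c, d` sends `α` to `-N/α`. Thus `α` is a root of `[a, b
+ Nc, Nd]`, which is `k` times the primitive form `q`. Comparing discriminants gives `k² D = (b -
Nc)² - 4N`, and the bound follows from `D < 0` and `k² ≥ 1`.

The analytic input is `exists_smul_eq_of_modularJ_eq`. Equal `J` means that `(E₄, E₆)` agree up to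
weights `c⁴, c⁶`. By induction on the weight the same scaling holds for every level one form, so
`ℤτ' + ℤ` and `c⁻¹(ℤτ + ℤ)` have equal lattice sums. These sums are the Laurent coefficients of `℘`,
whose poles recover the lattice. -/

/-! ### Level one forms are governed by `E₄` and `E₆`. -/

open UpperHalfPlane ModularForm ModularFormClass MatrixGroups EisensteinSeries in
/-- If `E₄` and `E₆` at two points differ by a scaling, then so does every form of level one. -/
theorem ModularForm.levelOne_apply_eq_pow_mul {τ τ' : ℍ} {c : ℂ}
    (h4 : E₄ τ' = c ^ 4 * E₄ τ) (h6 : E₆ τ' = c ^ 6 * E₆ τ) (k : ℕ)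
    (f : ModularForm 𝒮ℒ k) : f τ' = c ^ k * f τ := by
  have hΔ : discriminant τ' = c ^ 12 * discriminant τ := by
    rw [discriminant_eq_E₄_cube_sub_E₆_sq, discriminant_eq_E₄_cube_sub_E₆_sq, h4, h6]
    ring
  induction k using Nat.strong_induction_on with
  | _ k ih =>
    rcases Nat.even_or_odd k with hk | hk
    swap
    · rw [levelOne_odd_weight_eq_zero (mod_cast hk) f]
      simp
    rcases eq_or_ne k 0 with rfl | hk0
    · obtain ⟨x, hx⟩ := levelOne_weight_zero_const f
      simp [hx]
    rcases eq_or_ne k 2 with rfl | hk2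
    · rw [rank_zero_iff_forall_zero.mp levelOne_weight_two_rank_zero f]
      simp
    obtain ⟨a, b, hab⟩ : ∃ a b : ℕ, 4 * a + 6 * b = k := by
      obtain ⟨m, rfl⟩ := hk
      rcases Nat.even_or_odd m with ⟨n, rfl⟩ | ⟨n, rfl⟩
      · exact ⟨n, 0, by lia⟩
      · exact ⟨n - 1, 1, by lia⟩
    let M : ModularForm 𝒮ℒ k :=
      ModularForm.mcast (by rw [← hab]; push_cast; ring) ((E₄.pow a).mul (E₆.pow b))
    have hM (z : ℍ) : M z = E₄ z ^ a * E₆ z ^ b := by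
      simp [M, mcast_apply]
    have hMc : (qExpansion 1 M).coeff 0 = 1 := by
      have e : qExpansion 1 M = qExpansion 1 E₄ ^ a * qExpansion 1 E₆ ^ b := by
        rw [← ModularForm.qExpansion_pow one_pos one_mem_strictPeriods_SL E₄,
          ← ModularForm.qExpansion_pow one_pos one_mem_strictPeriods_SL E₆]
        exact ModularForm.qExpansion_mul_coe one_pos one_mem_strictPeriods_SL
          (E₄.pow a) (E₆.pow b)
      have e4 := E_qExpansion_coeff_zero (k := 4) (by norm_num) ⟨2, rfl⟩
      have e6 := E_qExpansion_coeff_zero (k := 6) (by norm_num) ⟨3, rfl⟩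
      rw [PowerSeries.coeff_zero_eq_constantCoeff_apply] at e4 e6 ⊢
      rw [e, map_mul, map_pow, map_pow, e4, e6]
      simp
    set x := (qExpansion 1 f).coeff 0 with hx
    have hcusp : (qExpansion 1 ⇑(f - x • M)).coeff 0 = 0 := by
      rw [FunLike.coe_sub, ModularForm.qExpansion_sub one_pos one_mem_strictPeriods_SL f (x • M),
        FunLike.coe_smul, ModularForm.qExpansion_smul one_pos one_mem_strictPeriods_SL, map_sub,
        PowerSeries.coeff_smul, hMc, smul_eq_mul, mul_one, sub_self]
    -- Dividing the cusp form `f - x M` by `Δ` lowers the weight by 12, which drives the induction.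
    let g := CuspForm.discriminantEquiv (toCuspForm (f - x • M) hcusp)
    have hg (z : ℍ) : f z = x * M z + discriminant z * g z := by
      have : discriminant z * g z = (f - x • M) z :=
        discriminant_mul_discriminantEquiv_apply (toCuspForm (f - x • M) hcusp) z
      rw [this]
      simp
    have hgc : discriminant τ' * g τ' = c ^ k * (discriminant τ * g τ) := by
      rcases lt_or_ge k 12 with hlt | hge
      · have : g = 0 := rank_zero_iff_forall_zero.mp (levelOne_neg_weight_rank_zero (by lia)) g
        simp [this]
      · have := ih (k - 12) (by lia) (ModularForm.mcast (by push_cast [hge]; ring) g)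
        rw [mcast_apply, mcast_apply] at this
        have hpow : c ^ k = c ^ 12 * c ^ (k - 12) := by rw [← pow_add, Nat.add_sub_cancel' hge]
        rw [this, hΔ, hpow]
        ring
    have hpow : c ^ k = (c ^ 4) ^ a * (c ^ 6) ^ b := by rw [← hab]; ring
    rw [hg, hg, hgc, hM, hM, h4, h6, hpow]
    ring

/-! ### Lattices, lattice sums and `℘`. -/

namespace PeriodPair

/-- A lattice is determined by its lattice sums, as the set of poles of `℘`. -/
theorem lattice_le_of_G_eq {L L' : PeriodPair} (h : ∀ n, 3 ≤ n → L.G n = L'.G n) : L.lattice ≤ L'.lattice := by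
  have h0 : ∀ᶠ z in nhds (0 : ℂ), L.weierstrassPExcept 0 z = L'.weierstrassPExcept 0 z := by
    have h1 := L.hasFPowerSeriesAt_weierstrassPExcept 0
    have h2 := L'.hasFPowerSeriesAt_weierstrassPExcept 0
    simp only [weierstrassPExcept_zero, sumInvPow_zero] at h1 h2
    filter_upwards [h1.eventually_hasSum_sub, h2.eventually_hasSum_sub] with z hz hz'
    refine hz.unique (hz'.congr_fun fun i ↦ ?_)
    -- The constant coefficient involves no lattice sum; degree `i + 1` involves `G (i + 3)`, whence
    -- the bound `3 ≤ n`.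
    rcases i with - | i
    · simp [FormalMultilinearSeries.ofScalars]
    · simp [FormalMultilinearSeries.ofScalars, h (i + 1 + 2) (by lia)]
  have hE (L : PeriodPair) (z : ℂ) :
      L.weierstrassP z = L.weierstrassPExcept 0 z + 1 / z ^ 2 := by
    have := L.weierstrassPExcept_add 0 z
    simpa using this.symm
  -- Removing countably many points leaves a connected dense set, so the identity theorem applies.
  set U : Set ℂ := ((L.lattice : Set ℂ) ∪ L'.lattice)ᶜ with hU
  have hctb (L : PeriodPair) : (L.lattice : Set ℂ).Countable := by
    have : Countable L.lattice := L.latticeEquivProd.toEquiv.countable_iff.mpr inferInstance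
    exact Set.to_countable _
  have hopen : IsOpen U := (L.isClosed_lattice.union L'.isClosed_lattice).isOpen_compl
  have hpre : IsPreconnected U :=
    (((hctb L).union (hctb L')).isConnected_compl_of_one_lt_rank
      (by simp [Complex.rank_real_complex])).isPreconnected
  have hdense : Dense U := ((hctb L).union (hctb L')).dense_compl ℝ
  obtain ⟨V, hV, hVo, hV0⟩ := eventually_nhds_iff.1 h0
  obtain ⟨z₀, hz₀V, hz₀⟩ := hdense.inter_open_nonempty V hVo ⟨0, hV0⟩
  have heq : Set.EqOn L.weierstrassP L'.weierstrassP U := by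
    refine (L.analyticOnNhd_weierstrassP.mono ?_).eqOn_of_preconnected_of_eventuallyEq
      (L'.analyticOnNhd_weierstrassP.mono ?_) hpre hz₀ ?_
    · exact Set.compl_subset_compl.2 Set.subset_union_left
    · exact Set.compl_subset_compl.2 Set.subset_union_right
    · filter_upwards [hVo.mem_nhds hz₀V] with z hz
      rw [hE, hE, hV z hz]
  intro l hl
  by_contra hl'
  -- At `l` one function has a double pole and the other is analytic, yet they agree on a punctured
  -- neighbourhood.
  have hUl : ∀ᶠ z in nhdsWithin l {l}ᶜ, z ∈ U := by
    rw [eventually_nhdsWithin_iff]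
    filter_upwards [L.compl_lattice_sdiff_singleton_mem_nhds l,
      L'.compl_lattice_sdiff_singleton_mem_nhds l] with z hz hz' hzl
    simp only [Set.mem_compl_iff, Set.mem_sdiff, Set.mem_singleton_iff] at hz hz' hzl
    simp only [hU, Set.mem_compl_iff, Set.mem_union]
    tauto
  have h1 := L.order_weierstrassP l hl
  have h2 := (L'.analyticOnNhd_weierstrassP l hl').meromorphicOrderAt_nonneg
  rw [← meromorphicOrderAt_congr (f₁ := L.weierstrassP), h1] at h2
  · exact absurd h2 (by decide)
  · filter_upwards [hUl] with z hz using heq hz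

/-- The lattice `c (ℤ τ + ℤ)` attached to a point of the upper half-plane. -/
noncomputable def ofUpperHalfPlane (c : ℂ) (hc : c ≠ 0) (τ : ℍ) : PeriodPair where
  ω₁ := c * τ
  ω₂ := c
  indep := by
    rw [LinearIndependent.pair_iff]
    intro s t h
    have h1 : (s : ℂ) * τ + t = 0 := by
      apply mul_left_cancel₀ hc
      simp only [Complex.real_smul] at h
      linear_combination h
    have h2 := congrArg Complex.im h1
    have h3 := congrArg Complex.re h1
    simp [τ.im_pos.ne'] at h2
    subst h2
    simpa using h3

-- Lattice sums are homogeneous of degree `-k`, so this reduces to the Eisenstein series of `ℤτ +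
-- ℤ`.
open UpperHalfPlane ModularForm ModularFormClass MatrixGroups EisensteinSeries in
theorem G_ofUpperHalfPlane (c : ℂ) (hc : c ≠ 0) (τ : ℍ) {k : ℕ} (hk : 3 ≤ k) :
    (ofUpperHalfPlane c hc τ).G k = (c ^ k)⁻¹ * (2 * riemannZeta k * E hk τ) := by
  have h1 := tsum_eisSummand_eq_riemannZeta_mul_eisensteinSeries hk τ
  have h2 : E hk τ = (1 / 2 : ℂ) * eisensteinSeries (N := 1) 0 k τ := rfl
  rw [h2, show 2 * riemannZeta k * (1 / 2 * eisensteinSeries (N := 1) 0 k τ) =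
    riemannZeta k * eisensteinSeries (N := 1) 0 k τ by ring, ← h1, ← tsum_mul_left, G,
    ← (finTwoArrowEquiv ℤ).symm.tsum_eq,
    ← (ofUpperHalfPlane c hc τ).latticeEquivProd.symm.toEquiv.tsum_eq]
  refine tsum_congr fun v ↦ ?_
  have := (ofUpperHalfPlane c hc τ).latticeEquiv_symm_apply v
  simp only [LinearEquiv.coe_toEquiv] at this ⊢
  rw [this]
  simp [eisSummand, ofUpperHalfPlane]
  rw [← mul_inv, ← mul_pow]
  ring_nf

end PeriodPair

/-! ### Injectivity of `J` modulo `SL(2, ℤ)`. -/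

open ModularForm in
/-- The modular invariant determines `(E₄, E₆)` up to scaling. -/
theorem exists_E₄_E₆_eq_of_modularJ_eq {τ τ' : ℍ} (h : modularJ τ' = modularJ τ) :
    ∃ c : ℂ, c ≠ 0 ∧ E₄ τ' = c ^ 4 * E₄ τ ∧ E₆ τ' = c ^ 6 * E₆ τ := by
  have d := discriminant_ne_zero τ
  have d' := discriminant_ne_zero τ'
  have e := discriminant_eq_E₄_cube_sub_E₆_sq τ
  have e' := discriminant_eq_E₄_cube_sub_E₆_sq τ'
  have hJ : E₄ τ' ^ 3 / discriminant τ' = E₄ τ ^ 3 / discriminant τ := h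
  rw [div_eq_div_iff d' d] at hJ
  have key : E₄ τ' ^ 3 * E₆ τ ^ 2 = E₄ τ ^ 3 * E₆ τ' ^ 2 := by
    rw [e, e'] at hJ
    linear_combination -1728 * hJ
  rw [e] at d
  rw [e'] at d'
  generalize E₄ τ = u, E₄ τ' = u', E₆ τ = v, E₆ τ' = v' at *
  have root (n : ℕ) (hn : 0 < n) (x : ℂ) (hx : x ≠ 0) : ∃ c : ℂ, c ≠ 0 ∧ c ^ n = x := by
    obtain ⟨c, hc⟩ := IsAlgClosed.exists_pow_nat_eq x hn
    refine ⟨c, ?_, hc⟩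
    rintro rfl
    exact hx (by rw [← hc, zero_pow hn.ne'])
  by_cases hu : u = 0
  · have hv : v ≠ 0 := by rintro rfl; simp [hu] at d
    have hu' : u' = 0 := by simpa [hu, hv] using key
    have hv' : v' ≠ 0 := by rintro rfl; simp [hu'] at d'
    obtain ⟨c, hc, h6⟩ := root 6 (by norm_num) (v' / v) (div_ne_zero hv' hv)
    exact ⟨c, hc, by simp [hu, hu'], by rw [h6]; field_simp⟩
  by_cases hv : v = 0
  · have hv' : v' = 0 := by simpa [hu, hv] using key
    have hu' : u' ≠ 0 := by rintro rfl; simp [hv'] at d'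
    obtain ⟨c, hc, h4⟩ := root 4 (by norm_num) (u' / u) (div_ne_zero hu' hu)
    exact ⟨c, hc, by rw [h4]; field_simp, by simp [hv, hv']⟩
  have hu' : u' ≠ 0 := by
    rintro rfl
    have : v' = 0 := by simpa [hu] using key
    simp [this] at d'
  have hv' : v' ≠ 0 := by
    rintro rfl
    simp [hu', hv] at key
  -- The two scalings force `c² = c⁶ / c⁴`; `key` shows that this choice satisfies both.
  obtain ⟨c, hc, h2⟩ := root 2 (by norm_num) ((v' / v) / (u' / u)) (by positivity)
  refine ⟨c, hc, ?_, ?_⟩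
  · rw [show c ^ 4 = (c ^ 2) ^ 2 by ring, h2]
    field_simp
    linear_combination key
  · rw [show c ^ 6 = (c ^ 2) ^ 3 by ring, h2]
    field_simp
    linear_combination key

open MatrixGroups in
/-- The modular invariant separates the `SL(2, ℤ)`-orbits of the upper half-plane. -/
theorem exists_smul_eq_of_modularJ_eq {τ τ' : ℍ} (h : modularJ τ' = modularJ τ) :
    ∃ g : SL(2, ℤ), g • τ = τ' := by
  obtain ⟨c, hc, h4, h6⟩ := exists_E₄_E₆_eq_of_modularJ_eq h
  have hG (k : ℕ) (hk : 3 ≤ k) :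
      (PeriodPair.ofUpperHalfPlane 1 one_ne_zero τ').G k =
        (PeriodPair.ofUpperHalfPlane c⁻¹ (inv_ne_zero hc) τ).G k := by
    rw [PeriodPair.G_ofUpperHalfPlane _ _ _ hk, PeriodPair.G_ofUpperHalfPlane _ _ _ hk,
      ModularForm.levelOne_apply_eq_pow_mul h4 h6]
    simp
    ring
  have l1 := PeriodPair.lattice_le_of_G_eq hG
  have l2 := PeriodPair.lattice_le_of_G_eq fun n hn ↦ (hG n hn).symm
  obtain ⟨a, b, h1⟩ := PeriodPair.mem_lattice.1 (l1 (PeriodPair.ω₁_mem_lattice _))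
  obtain ⟨p, q, h2⟩ := PeriodPair.mem_lattice.1 (l1 (PeriodPair.ω₂_mem_lattice _))
  obtain ⟨a', b', h1'⟩ := PeriodPair.mem_lattice.1 (l2 (PeriodPair.ω₁_mem_lattice _))
  obtain ⟨p', q', h2'⟩ := PeriodPair.mem_lattice.1 (l2 (PeriodPair.ω₂_mem_lattice _))
  simp only [PeriodPair.ofUpperHalfPlane, one_mul, mul_one] at h1 h2 h1' h2'
  have e : c * c⁻¹ = 1 := mul_inv_cancel₀ hc
  -- The scaling constant `c` is the automorphy factor of the matrix sought.
  have s2 : (p : ℂ) * τ + q = c := by linear_combination c * h2 - (p * τ + q) * e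
  have r1 : (τ' : ℂ) * (p * τ + q) = a * τ + b := by
    linear_combination τ' * s2 - c * h1 + (a * τ + b) * e
  have r2 : (τ : ℂ) * (p' * τ' + q') = a' * τ' + b' := by
    linear_combination τ * h2' - h1'
  have r3 : (p * τ + q : ℂ) * (p' * τ' + q') = 1 := by
    rw [s2, h2', e]
  -- Imaginary parts make both determinants positive, which excludes `-1`.
  have im : ∀ {s t : ℍ} {a b c d : ℤ}, (s : ℂ) * (c * t + d) = a * t + b →
      s.im * Complex.normSq (c * t + d) = ((a * d - b * c : ℤ) : ℝ) * t.im := by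
    intro s t a b c d h
    have h1 := congrArg Complex.re h
    have h2 := congrArg Complex.im h
    simp at h1 h2
    simp [Complex.normSq_apply]
    linear_combination (c * t.re + d) * h2 - c * t.im * h1
  have i1 := im r1
  have i2 := im r2
  have n3 := congrArg Complex.normSq r3
  rw [map_mul, map_one] at n3
  have n1 : 0 < Complex.normSq (p * τ + q) :=
    Complex.normSq_pos.2 (left_ne_zero_of_mul_eq_one r3)
  have p1 : 0 < a * q - b * p := by
    have := mul_pos τ'.im_pos n1
    rw [i1] at this
    exact_mod_cast pos_of_mul_pos_left this τ.im_pos.le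
  have p3 : (a * q - b * p) * (a' * q' - b' * p') = 1 := by
    have hpos : (τ'.im * τ.im : ℝ) ≠ 0 := (mul_pos τ'.im_pos τ.im_pos).ne'
    have : (((a * q - b * p : ℤ) : ℝ) * ((a' * q' - b' * p' : ℤ) : ℝ)) = 1 := by
      apply mul_right_cancel₀ hpos
      linear_combination τ'.im * τ.im * n3 -
        ((a' * q' - b' * p' : ℤ) : ℝ) * τ'.im * i1 - τ'.im * Complex.normSq (p * τ + q) * i2
    exact_mod_cast this
  have hdet : a * q - b * p = 1 := by
    rcases Int.eq_one_or_neg_one_of_mul_eq_one p3 with h | h <;> omega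
  let g : SL(2, ℤ) := ⟨!![a, b; p, q], by rw [Matrix.det_fin_two_of, hdet]⟩
  refine ⟨g, ?_⟩
  ext
  rw [UpperHalfPlane.coe_specialLinearGroup_apply]
  simp [g]
  rw [← r1, mul_div_cancel_right₀ _ (left_ne_zero_of_mul_eq_one r3)]

/-! ### Quadratic forms and their discriminants. -/

/-- The discriminant of an imaginary quadratic field is negative. -/
theorem NumberField.discr_neg_of_isQuadraticExtension (K : Type*) [Field K] [NumberField K]
    [Algebra.IsQuadraticExtension ℚ K] [NumberField.IsTotallyComplex K] :
    NumberField.discr K < 0 := by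
  have h1 := NumberField.InfinitePlace.card_add_two_mul_card_eq_rank K
  rw [NumberField.IsTotallyComplex.nrRealPlaces_eq_zero,
    Algebra.IsQuadraticExtension.finrank_eq_two] at h1
  have h2 := NumberField.sign_discr K
  rw [show NumberField.InfinitePlace.nrComplexPlaces K = 1 by lia, pow_one] at h2
  exact Int.sign_eq_neg_one_iff_neg.1 h2

/-- The roots of `[a, b + N c, N d]` are the solutions of `(a τ + b) / (c τ + d) = -N / τ`. If this
form is a multiple of a form of negative discriminant `D` with `N ∣ C`, then `D ≥ -4 N`, with
equality if and only if `2 N` divides the middle coefficient. -/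
theorem QuadForm.neg_four_mul_le_disc {q : QuadForm} {N a b c d k : ℤ} (hN : 1 < N)
    (hD : q.disc < 0) (hC : N ∣ q.C) (hdet : a * d - b * c = 1) (ha : a = k * q.A)
    (hb : b + N * c = k * q.B) (hd : N * d = k * q.C) :
    -(4 * N) ≤ q.disc ∧ (q.disc = -(4 * N) ↔ 2 * N ∣ q.B) := by
  have key : k ^ 2 * q.disc = (b - N * c) ^ 2 - 4 * N := by
    rw [QuadForm.disc]
    linear_combination (-k * q.B - b - N * c) * hb + 4 * a * hd + 4 * k * q.C * ha - 4 * N * hdet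
  -- `k = 0` would give `a = 0` and `b = -Nc`, so `Nc² = 1`, against `N > 1`.
  have hk : k ≠ 0 := by
    rintro rfl
    have h1 : N * c ^ 2 = 1 := by
      have h2 : a = 0 := by simpa using ha
      rw [h2] at hdet
      linear_combination hdet + c * hb
    have := Int.eq_one_or_neg_one_of_mul_eq_one h1
    lia
  have hk1 : 1 ≤ k ^ 2 := by have := sq_pos_of_ne_zero hk; lia
  have hle : -(4 * N) ≤ q.disc := by nlinarith [sq_nonneg (b - N * c)]
  refine ⟨hle, fun h ↦ ?_, fun ⟨m, hm⟩ ↦ ?_⟩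
  · rw [h] at key
    have hk2 : k ^ 2 = 1 := by nlinarith [sq_nonneg (b - N * c)]
    have hbc : b - N * c = 0 := by
      rw [hk2] at key
      exact pow_eq_zero_iff two_ne_zero |>.1 (by linear_combination -key)
    refine ⟨k * c, ?_⟩
    linear_combination -q.B * hk2 - k * hb + k * hbc
  -- Here `4N` divides the discriminant, and `-4N` is the only negative multiple within the bound.
  · obtain ⟨n, hn⟩ := hC
    have : q.disc = 4 * N * (N * m ^ 2 - q.A * n) := by
      rw [QuadForm.disc, hm, hn]
      ring
    rw [this] at hle hD ⊢
    have h1 : N * m ^ 2 - q.A * n < 0 := by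
      by_contra!
      have := mul_nonneg (show 0 ≤ 4 * N by lia) this
      lia
    have h2 : -1 ≤ N * m ^ 2 - q.A * n := by
      by_contra!
      nlinarith
    rw [show N * m ^ 2 - q.A * n = -1 by lia]
    ring

/-- An integral quadratic polynomial with the same non-real root as a primitive form is an integral
multiple of that form. -/
theorem QuadForm.exists_eq_mul_of_root {q : QuadForm} (hq : q.IsPrimitive) (hA : q.A ≠ 0)
    {τ : ℂ} (hτ : τ.im ≠ 0) (h : q.A * τ ^ 2 + q.B * τ + q.C = 0) {a b c : ℤ}
    (h' : a * τ ^ 2 + b * τ + c = 0) :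
    ∃ k : ℤ, a = k * q.A ∧ b = k * q.B ∧ c = k * q.C := by
  -- Eliminating `τ²` leaves a linear relation, trivial because `τ` is not real.
  have hlin : ((q.A * b - a * q.B : ℤ) : ℂ) * τ + ((q.A * c - a * q.C : ℤ) : ℂ) = 0 := by
    push_cast
    linear_combination q.A * h' - a * h
  have h1 : q.A * b - a * q.B = 0 := by
    have := congrArg Complex.im hlin
    rw [Complex.add_im, Complex.intCast_im, ← Complex.ofReal_intCast, Complex.im_ofReal_mul, add_zero,
      Complex.zero_im, mul_eq_zero] at this
    exact_mod_cast this.resolve_right hτ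
  have h2 : q.A * c - a * q.C = 0 := by
    rw [h1] at hlin
    exact_mod_cast (by simpa using hlin : ((q.A * c - a * q.C : ℤ) : ℂ) = 0)
  have e1 := Int.gcd_eq_gcd_ab q.A q.B
  have e2 := Int.gcd_eq_gcd_ab (Int.gcd q.A q.B) q.C
  rw [QuadForm.IsPrimitive] at hq
  rw [hq, e1] at e2
  generalize Int.gcdA q.A q.B = x, Int.gcdB q.A q.B = y at *
  generalize Int.gcdA _ q.C = z, Int.gcdB _ q.C = w at *
  -- The witness applies the Bézout combination of `A, B, C` equal to 1 to `a, b, c`.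
  obtain ⟨k, hk⟩ : ∃ k, a = k * q.A :=
    ⟨x * z * a + y * z * b + w * c, by
      push_cast at e2
      linear_combination a * e2 - y * z * h1 - w * h2⟩
  refine ⟨k, hk, mul_left_cancel₀ hA ?_, mul_left_cancel₀ hA ?_⟩
  · linear_combination h1 + q.B * hk
  · linear_combination h2 + q.C * hk

/-! ### The bound on the discriminant. -/

theorem corollary4p4
    (K : Subfield ℂ) [NumberField K] [Algebra.IsQuadraticExtension ℚ K]
    [NumberField.IsTotallyComplex K]
    (f : ℕ) (hf : 0 < f) (D : ℤ) (hD : D = (f : ℤ) ^ 2 * NumberField.discr K)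
    (p₁ p₂ N : ℕ) (hp₁ : p₁.Prime) (hp₂ : p₂.Prime) (hN : N = p₁ * p₂)
    (hadm : AdmissiblePrimes D f p₁ p₂)
    (𝔑 : Set QuadForm) (h𝔑 : IsNSystem (orderOfConductor K f) N D 𝔑)
    (q : QuadForm) (hq : q ∈ 𝔑)
    (hJ : idealJ (atkinLehnerIdeal N D q) = idealJ (formIdeal D q)) :
    -(4 * (N : ℤ)) ≤ D ∧ (D = -(4 * (N : ℤ)) ↔ (2 * (N : ℤ)) ∣ q.B) := by
  have hD0 : D < 0 := by
    rw [hD]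
    have := NumberField.discr_neg_of_isQuadraticExtension K
    exact mul_neg_of_pos_of_neg (by positivity) this
  have hN1 : 1 < N := by
    rw [hN]
    nlinarith [hp₁.two_le, hp₂.two_le]
  have hA := h𝔑.pos q hq
  have hdisc := h𝔑.disc_eq q hq
  have hA' : (q.A : ℂ) ≠ 0 := by exact_mod_cast hA.ne'
  set α : ℂ := (-(q.B : ℂ) + sqrtNeg D) / (2 * q.A) with hα
  have him : 0 < α.im := by
    have e : α = (((2 * q.A : ℝ)⁻¹ : ℝ) : ℂ) * (-(q.B : ℂ) + sqrtNeg D) := by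
      rw [hα]
      push_cast
      field_simp
    have hDr : (0 : ℝ) < -(D : ℝ) := by
      have : (D : ℝ) < 0 := by exact_mod_cast hD0
      linarith
    have hAr : (0 : ℝ) < q.A := by exact_mod_cast hA
    rw [e, Complex.im_ofReal_mul]
    have := Real.sqrt_pos.2 hDr
    refine mul_pos (by positivity) ?_
    simpa [sqrtNeg] using this
  have hs : sqrtNeg D ^ 2 = (q.B : ℂ) ^ 2 - 4 * q.A * q.C := by
    have h0 : (0 : ℝ) ≤ -(D : ℝ) := by
      have : (D : ℝ) < 0 := by exact_mod_cast hD0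
      linarith
    rw [sqrtNeg, mul_pow, Complex.I_sq, ← Complex.ofReal_pow, Real.sq_sqrt h0, ← hdisc,
      QuadForm.disc]
    push_cast
    ring
  have hroot : q.A * α ^ 2 + q.B * α + q.C = 0 := by
    rw [hα]
    field_simp
    linear_combination hs
  have hα0 : α ≠ 0 := by
    intro h
    simp [h] at him
  have him' : 0 < (N / -α : ℂ).im := by
    rw [div_eq_mul_inv, ← Complex.ofReal_natCast, Complex.im_ofReal_mul, Complex.inv_im,
      Complex.neg_im, neg_neg]
    have := Complex.normSq_pos.2 (neg_ne_zero.2 hα0)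
    positivity
  let τ : ℍ := ⟨α, him⟩
  let σ : ℍ := ⟨N / -α, him'⟩
  rw [idealJ_eq (isBasisQuotient_formIdeal hA (τ := τ) rfl),
    idealJ_eq (isBasisQuotient_atkinLehnerIdeal (by lia) hD0 hdisc hA (τ := σ) rfl)] at hJ
  obtain ⟨g, hg⟩ := exists_smul_eq_of_modularJ_eq hJ
  have hg' := congrArg UpperHalfPlane.coe hg
  rw [UpperHalfPlane.coe_specialLinearGroup_apply] at hg'
  have hdet := g.det_coe
  rw [Matrix.det_fin_two] at hdet
  generalize g 0 0 = a, g 0 1 = b, g 1 0 = c, g 1 1 = d at hg' hdet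
  replace hg' : (a * α + b) / (c * α + d) = N / -α := by simpa [τ, σ] using hg'
  have hN0 : (N : ℂ) ≠ 0 := by
    have : N ≠ 0 := by lia
    exact_mod_cast this
  have hden : c * α + d ≠ 0 := by
    intro h
    rw [h, div_zero] at hg'
    exact div_ne_zero hN0 (neg_ne_zero.2 hα0) hg'.symm
  rw [div_eq_div_iff hden (neg_ne_zero.2 hα0)] at hg'
  obtain ⟨k, ha, hb, hd⟩ := QuadForm.exists_eq_mul_of_root (h𝔑.primitive q hq) hA.ne' him.ne'
    hroot (a := a) (b := b + N * c) (c := N * d) (by push_cast; linear_combination -hg')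
  rw [← hdisc] at hD0 ⊢
  exact QuadForm.neg_four_mul_le_disc (by exact_mod_cast hN1) hD0 (h𝔑.dvd q hq) hdet ha hb hd
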